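/- Let $E$ be a metric space. A curve in $E$ is a map $\gamma:[0,\ell(\gamma)]\to E$ parametrized by arc length, i.e. the restriction of $\gamma$ to $[0,t]$ has length $t$ for every $t\in[0,\ell(\gamma)]$, where $\ell(\gamma)\in[0,\infty)$ is the length of $\gamma$. It is closed if $\gamma(\ell(\gamma))=\gamma(0)$, a geodesic if $d(\gamma(s),\gamma(t))=|s-t|$ for all $s,t$, and piecewise geodesic if there are $0=s_0<s_1<\dots<s_k=\ell(\gamma)$ such that $\gamma$ restricted to each $[s_{i-1},s_i]$ is a geodesic. To $\gamma$ one associates the functional (metric $1$-current) $$[[\gamma]](f,\pi)=\int_0^{\ell(\gamma)}(f\circ\gamma)\,d(\pi\circ\gamma)$$ (a Riemann–Stieltjes integral), defined for all bounded Lipschitz $f:E\to\mathbb R$ and all Lipschitz $\pi:E\to\mathbb R$, and its Morrey norm $$\|\gamma\|_{M}=\sup_{x\in E,\ r>0}\frac{|\{t\in[0,\ell(\gamma)]: d(x,\gamma(t))\le r\}|}{r},$$ where $|\cdot|$ is Lebesgue measure. Suppose that $E$ is geodesic, i.e. any two points of $E$ are the endpoints of a geodesic. Let $0<\epsilon<1$,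 let $n\ge 1$ be an integer, and let $\gamma$ be a closed piecewise-geodesic curve in $E$. Then there exist an integer $N\ge1$ and closed piecewise-geodesic curves $\gamma_1,\dots,\gamma_N$ in $E$ such that 1. $[[\gamma]]=\sum_{j=1}^N[[\gamma_j]]$; 2. $\displaystyle\sum_{j=1}^N\ell(\gamma_j)\le\Bigl(1+\frac{2\epsilon}{1-\epsilon}+\frac{12\epsilon^{-1}}{n(1-\epsilon)}\Bigr)\ell(\gamma)$; 3. $\|\gamma_j\|_{M}\le 4\epsilon^{-1}+2n+10$ for every $j=1,\dots,N$. -/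

import Mathlib

namespace Surgery

/-- A curve in `E` parametrized by arc length on `[0, len]`: the length of the restriction of `γ`
to `[0, t]` is `t` for all `t ∈ [0, len]` (in particular `len` is the length of `γ`, and `γ` is
`1`-Lipschitz on `[0, len]`). The values of `toFun` outside `[0, len]` are never used. -/
structure ArcCurve (E : Type*) [MetricSpace E] where
  toFun : ℝ → E
  len : ℝ
  len_nonneg : 0 ≤ len
  arclength : ∀ t ∈ Set.Icc (0 : ℝ) len,
    eVariationOn toFun (Set.Icc 0 t) = ENNReal.ofReal t

/-- The Riemann-Stieltjes integral `∫ₐᵇ f dg` exists and equals `I`: the Riemann-Stieltjes sums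
over tagged partitions of `[a, b]` converge to `I` as the mesh tends to `0`. -/
def HasRSIntegral (f g : ℝ → ℝ) (a b I : ℝ) : Prop :=
  ∀ ε > 0, ∃ δ > 0, ∀ (k : ℕ) (s τ : ℕ → ℝ), s 0 = a → s k = b →
    (∀ i < k, s i ≤ τ i ∧ τ i ≤ s (i + 1) ∧ s (i + 1) - s i < δ) →
    |∑ i ∈ Finset.range k, f (τ i) * (g (s (i + 1)) - g (s i)) - I| < ε

open Classical in
/-- The Riemann-Stieltjes integral `∫ₐᵇ f dg` (with value `0` if it does not exist; it always
exists for Lipschitz `f` and `g`). -/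
noncomputable def rsIntegral (f g : ℝ → ℝ) (a b : ℝ) : ℝ :=
  if h : ∃ I, HasRSIntegral f g a b I then h.choose else 0

/-- Metric `1`-forms `(f, π)` on `E`: `f` is bounded and Lipschitz, `π` is Lipschitz. -/
structure OneForm (E : Type*) [MetricSpace E] where
  f : E → ℝ
  π : E → ℝ
  f_lipschitz : ∃ K, LipschitzWith K f
  f_bounded : ∃ C, ∀ x, |f x| ≤ C
  π_lipschitz : ∃ K, LipschitzWith K π

namespace ArcCurve

variable {E : Type*} [MetricSpace E]

/-- The metric `1`-current `[[γ]]`, as a functional on `1`-forms: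
`[[γ]](f, π) = ∫ (f ∘ γ) d(π ∘ γ)` over `[0, len]`. -/
noncomputable def current (γ : ArcCurve E) (ω : OneForm E) : ℝ :=
  rsIntegral (ω.f ∘ γ.toFun) (ω.π ∘ γ.toFun) 0 γ.len

/-- The Morrey norm of `γ`, the supremum over `x ∈ E` and `r > 0` of
`|{t ∈ [0, len] : d(x, γ(t)) ≤ r}| / r`. -/
noncomputable def morrey (γ : ArcCurve E) : ENNReal :=
  ⨆ (x : E) (r : ℝ) (_ : 0 < r),
    MeasureTheory.volume {t : ℝ | t ∈ Set.Icc 0 γ.len ∧ dist x (γ.toFun t) ≤ r} /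
      ENNReal.ofReal r

/-- The restriction of `γ` to `[a, b]` is a (length-minimizing) geodesic, i.e. an isometry onto
its image. -/
def IsGeodesicOn (γ : ArcCurve E) (a b : ℝ) : Prop :=
  ∀ u ∈ Set.Icc a b, ∀ v ∈ Set.Icc a b, dist (γ.toFun u) (γ.toFun v) = |u - v|

/-- `γ` is a (length-minimizing) geodesic. -/
def IsGeodesic (γ : ArcCurve E) : Prop := γ.IsGeodesicOn 0 γ.len

/-- `0 = s 0 < s 1 < ⋯ < s k = len` is a resolution of `γ` into geodesic edges. (`k = 0` occurs
exactly for constant curves, which have length `0`.) -/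
def IsResolution (γ : ArcCurve E) (k : ℕ) (s : ℕ → ℝ) : Prop :=
  s 0 = 0 ∧ s k = γ.len ∧ ∀ i < k, s i < s (i + 1) ∧ γ.IsGeodesicOn (s i) (s (i + 1))

/-- `γ` is a concatenation of finitely many geodesics. -/
def IsPiecewiseGeodesic (γ : ArcCurve E) : Prop := ∃ k s, γ.IsResolution k s

/-- `γ` ends where it starts. -/
def IsClosed (γ : ArcCurve E) : Prop := γ.toFun γ.len = γ.toFun 0

end ArcCurve

/-- Any two points of `E` are joined by a length-minimizing geodesic. -/
def IsGeodesicSpace (E : Type*) [MetricSpace E] : Prop :=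
  ∀ x y : E, ∃ γ : ArcCurve E, γ.IsGeodesic ∧ γ.toFun 0 = x ∧ γ.toFun γ.len = y

end Surgery

section

open Set MeasureTheory
open scoped NNReal

namespace Surgery

/-! Induction on the number of edges. Among arcs of the closed curve that contain two consecutive
edges and whose endpoints are at distance at most `ε` times the arc's length, take a shortest one,
of length `L` (`IsBrokenAt.exists_shortest_arc`). Join its endpoints by a geodesic chord. The arc
followed by the reversed chord is a loop `β`; replacing the arc by the chord leaves a closed curve
in which one edge stands for at least two. The chord cancels in the sum of currents.

By minimality, `g` does not contract by more than the factor `ε` between points of the arc with two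
full edges between them, while each single edge is isometric; this bounds the Morrey norm of `β`
(`IsBrokenAt.volume_le`). Since `β` has length at most `(1 + ε) * L` and the remaining curve is
shorter by at least `(1 - ε) * L`, the lengths add up to at most `(1 + ε) / (1 - ε)` times the
original one (`IsBroken.exists_split`, `IsBroken.exists_decomposition`).

Edges may be degenerate throughout, so that cutting inside an edge never disturbs the count. -/

/-! ### Riemann–Stieltjes integrals of Lipschitz functions as Lebesgue integrals -/

theorem HasRSIntegral.unique {f g : ℝ → ℝ} {a b I J : ℝ} (hab : a ≤ b)
    (hI : HasRSIntegral f g a b I) (hJ : HasRSIntegral f g a b J) : I = J := by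
  by_contra hne
  have hpos : 0 < |I - J| / 2 := by have := abs_pos.2 (sub_ne_zero.2 hne); linarith
  obtain ⟨δ₁, hδ₁, h₁⟩ := hI _ hpos
  obtain ⟨δ₂, hδ₂, h₂⟩ := hJ _ hpos
  obtain ⟨k, hk⟩ := exists_nat_gt ((b - a) / min δ₁ δ₂)
  have hδ : 0 < min δ₁ δ₂ := lt_min hδ₁ hδ₂
  have hk' : (b - a) / ((k : ℝ) + 1) < min δ₁ δ₂ := by
    rw [div_lt_iff₀ hδ] at hk
    rw [div_lt_iff₀ (by positivity)]
    nlinarith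
  set s : ℕ → ℝ := fun i => a + i * ((b - a) / ((k : ℝ) + 1)) with hs
  have hstep : ∀ i, s (i + 1) - s i = (b - a) / ((k : ℝ) + 1) := by
    intro i; simp only [hs]; push_cast; ring
  have hnn : 0 ≤ (b - a) / ((k : ℝ) + 1) := div_nonneg (by linarith) (by positivity)
  have hs0 : s 0 = a := by simp [hs]
  have hsk : s (k + 1) = b := by simp only [hs]; push_cast; field_simp; ring
  have e₁ := h₁ (k + 1) s s hs0 hsk fun i _ =>
    ⟨le_rfl, by linarith [hstep i], by linarith [hstep i, min_le_left δ₁ δ₂]⟩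
  have e₂ := h₂ (k + 1) s s hs0 hsk fun i _ =>
    ⟨le_rfl, by linarith [hstep i], by linarith [hstep i, min_le_right δ₁ δ₂]⟩
  rw [abs_lt] at e₁ e₂
  rcases abs_cases (I - J) with h | h <;> linarith

theorem HasRSIntegral.rsIntegral_eq {f g : ℝ → ℝ} {a b I : ℝ} (hab : a ≤ b)
    (hI : HasRSIntegral f g a b I) : rsIntegral f g a b = I := by
  have h : ∃ I, HasRSIntegral f g a b I := ⟨I, hI⟩
  rw [rsIntegral, dif_pos h]
  exact h.choose_spec.unique hab hI

theorem intervalIntegrable_mul_deriv {f g : ℝ → ℝ} {a b : ℝ} {C : ℝ≥0} (hab : a ≤ b)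
    (hf : ContinuousOn f (Icc a b)) (hg : LipschitzOnWith C g (Icc a b)) :
    IntervalIntegrable (fun x => f x * deriv g x) volume a b := by
  rw [← uIcc_of_le hab] at hf hg
  exact hg.absolutelyContinuousOnInterval.intervalIntegrable_deriv.continuousOn_mul hf

theorem integral_deriv_eq_sub_of_lipschitzOn {g : ℝ → ℝ} {a b : ℝ} {C : ℝ≥0} (hab : a ≤ b)
    (hg : LipschitzOnWith C g (Icc a b)) : ∫ x in a..b, deriv g x = g b - g a := by
  rw [← uIcc_of_le hab] at hg
  exact hg.absolutelyContinuousOnInterval.integral_deriv_eq_sub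

theorem abs_sub_integral_mul_deriv_le {f g : ℝ → ℝ} {a b τ : ℝ} {K C : ℝ≥0}
    (hf : LipschitzOnWith K f (Icc a b)) (hg : LipschitzOnWith C g (Icc a b))
    (hτ : τ ∈ Icc a b) :
    |f τ * (g b - g a) - ∫ x in a..b, f x * deriv g x| ≤ K * (b - a) * C * (b - a) := by
  have hab : a ≤ b := hτ.1.trans hτ.2
  have hi := intervalIntegrable_mul_deriv hab hf.continuousOn hg
  have hi' := intervalIntegrable_mul_deriv hab (continuousOn_const (c := f τ)) hg
  rw [← integral_deriv_eq_sub_of_lipschitzOn hab hg, ← intervalIntegral.integral_const_mul,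
    ← intervalIntegral.integral_sub hi' hi]
  have key : ∀ᵐ x, x ∈ uIoc a b →
      ‖f τ * deriv g x - f x * deriv g x‖ ≤ K * (b - a) * C := by
    have hb : ∀ᵐ x : ℝ, x ≠ b := by simp [ae_iff, measure_singleton]
    filter_upwards [hb] with x hxb hx
    rw [uIoc_of_le hab] at hx
    have hxb' : x < b := lt_of_le_of_ne hx.2 hxb
    have hxI : x ∈ Icc a b := ⟨hx.1.le, hx.2⟩
    rw [← sub_mul, norm_mul]
    have h1 : ‖f τ - f x‖ ≤ K * (b - a) := by
      have := hf.dist_le_mul τ hτ x hxI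
      rw [dist_eq_norm] at this
      refine this.trans (mul_le_mul_of_nonneg_left ?_ K.2)
      rw [Real.dist_eq, abs_le]
      constructor <;> linarith [hτ.1, hτ.2, hxI.1, hxI.2]
    have h2 : ‖deriv g x‖ ≤ C := norm_deriv_le_of_lipschitzOn (Icc_mem_nhds hx.1 hxb') hg
    exact mul_le_mul h1 h2 (norm_nonneg _) (mul_nonneg K.2 (by linarith))
  have := intervalIntegral.norm_integral_le_of_norm_le_const_ae key
  rwa [Real.norm_eq_abs, abs_of_nonneg (by linarith : 0 ≤ b - a)] at this

theorem hasRSIntegral_integral_mul_deriv {f g : ℝ → ℝ} {a b : ℝ} {K C : ℝ≥0} (hab : a ≤ b)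
    (hf : LipschitzOnWith K f (Icc a b)) (hg : LipschitzOnWith C g (Icc a b)) :
    HasRSIntegral f g a b (∫ x in a..b, f x * deriv g x) := by
  intro ε hε
  have hba : 0 ≤ b - a := by linarith
  have hD : 0 < (K : ℝ) * C * (b - a) + 1 := by
    have : 0 ≤ (K : ℝ) * C * (b - a) := by positivity
    linarith
  -- The errors on the pieces sum to at most `K * C * (b - a) * δ`; the `+ 1` makes the final
  -- inequality strict and the denominator nonzero.
  refine ⟨ε / (K * C * (b - a) + 1), by positivity, fun k s τ hs0 hsk h => ?_⟩
  set δ := ε / (K * C * (b - a) + 1) with hδ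
  have hδ0 : 0 < δ := by positivity
  have hmono : ∀ j ≤ k, ∀ i ≤ j, s i ≤ s j := by
    intro j hj i hij
    induction j, hij using Nat.le_induction with
    | base => exact le_rfl
    | succ j hij ih =>
      exact (ih (by omega)).trans ((h j (by omega)).1.trans (h j (by omega)).2.1)
  have hsub : ∀ i < k, Icc (s i) (s (i + 1)) ⊆ Icc a b := fun i hi =>
    Icc_subset_Icc (hs0 ▸ hmono i hi.le 0 (Nat.zero_le _)) (hsk ▸ hmono k le_rfl (i + 1) hi)
  have hsum : ∫ x in a..b, f x * deriv g x =
      ∑ i ∈ Finset.range k, ∫ x in s i..s (i + 1), f x * deriv g x := by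
    rw [intervalIntegral.sum_integral_adjacent_intervals, hs0, hsk]
    intro i hi
    exact intervalIntegrable_mul_deriv ((h i hi).1.trans (h i hi).2.1)
      (hf.continuousOn.mono (hsub i hi)) (hg.mono (hsub i hi))
  rw [hsum, ← Finset.sum_sub_distrib]
  have htel : ∑ i ∈ Finset.range k, (s (i + 1) - s i) = b - a := by
    rw [Finset.sum_range_sub, hs0, hsk]
  calc _ ≤ ∑ i ∈ Finset.range k, K * C * δ * (s (i + 1) - s i) := by
        refine (Finset.abs_sum_le_sum_abs _ _).trans (Finset.sum_le_sum fun i hi => ?_)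
        have hi := Finset.mem_range.1 hi
        obtain ⟨h1, h2, h3⟩ := h i hi
        refine (abs_sub_integral_mul_deriv_le (hf.mono (hsub i hi)) (hg.mono (hsub i hi))
          ⟨h1, h2⟩).trans ?_
        have h4 : 0 ≤ s (i + 1) - s i := by linarith
        refine mul_le_mul_of_nonneg_right ?_ h4
        rw [mul_right_comm]
        exact mul_le_mul_of_nonneg_left h3.le (by positivity)
    _ = K * C * (b - a) * δ := by rw [← Finset.mul_sum, htel]; ring
    _ < (K * C * (b - a) + 1) * δ := by nlinarith
    _ = ε := by rw [hδ]; field_simp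

theorem rsIntegral_eq_integral_mul_deriv {f g : ℝ → ℝ} {a b : ℝ} {K C : ℝ≥0} (hab : a ≤ b)
    (hf : LipschitzOnWith K f (Icc a b)) (hg : LipschitzOnWith C g (Icc a b)) :
    rsIntegral f g a b = ∫ x in a..b, f x * deriv g x :=
  (hasRSIntegral_integral_mul_deriv hab hf hg).rsIntegral_eq hab

/-! ### Integrals of forms along curves -/

variable {E : Type*} [MetricSpace E]

namespace OneForm

/-- The integral of the form `ω` along `g` restricted to `[a, b]`. -/
noncomputable def integral (ω : OneForm E) (g : ℝ → E) (a b : ℝ) : ℝ :=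
  ∫ x in a..b, ω.f (g x) * deriv (fun y => ω.π (g y)) x

variable (ω : OneForm E) {g h : ℝ → E} {a b c : ℝ}

@[simp]
theorem integral_same : ω.integral g a a = 0 := intervalIntegral.integral_same

theorem rsIntegral_eq (hab : a ≤ b) (hg : LipschitzOnWith 1 g (Icc a b)) :
    rsIntegral (ω.f ∘ g) (ω.π ∘ g) a b = ω.integral g a b := by
  obtain ⟨K, hK⟩ := ω.f_lipschitz
  obtain ⟨C, hC⟩ := ω.π_lipschitz
  exact rsIntegral_eq_integral_mul_deriv hab (hK.comp_lipschitzOnWith hg)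
    (hC.comp_lipschitzOnWith hg)

theorem intervalIntegrable (hab : a ≤ b) (hg : LipschitzOnWith 1 g (Icc a b)) :
    IntervalIntegrable (fun x => ω.f (g x) * deriv (fun y => ω.π (g y)) x) volume a b := by
  obtain ⟨K, hK⟩ := ω.f_lipschitz
  obtain ⟨C, hC⟩ := ω.π_lipschitz
  exact intervalIntegrable_mul_deriv hab (hK.comp_lipschitzOnWith hg).continuousOn
    (hC.comp_lipschitzOnWith hg)

theorem integral_add_adjacent (hab : a ≤ b) (hbc : b ≤ c)
    (hg : LipschitzOnWith 1 g (Icc a c)) :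
    ω.integral g a b + ω.integral g b c = ω.integral g a c :=
  intervalIntegral.integral_add_adjacent_intervals
    (ω.intervalIntegrable hab (hg.mono (Icc_subset_Icc_right hbc)))
    (ω.intervalIntegrable hbc (hg.mono (Icc_subset_Icc_left hab)))

theorem integral_congr (hab : a ≤ b) (hgh : EqOn g h (Icc a b)) :
    ω.integral g a b = ω.integral h a b := by
  refine intervalIntegral.integral_congr_ae ?_
  have hb : ∀ᵐ x : ℝ, x ≠ b := by simp [ae_iff, measure_singleton]
  filter_upwards [hb] with x hxb hx
  rw [uIoc_of_le hab] at hx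
  -- `deriv` sees values outside `[a, b]` only at the endpoints, a null set.
  have hn : Icc a b ∈ nhds x := Icc_mem_nhds hx.1 (lt_of_le_of_ne hx.2 hxb)
  have he : (fun y => ω.π (g y)) =ᶠ[nhds x] fun y => ω.π (h y) := by
    filter_upwards [hn] with y hy
    rw [hgh hy]
  rw [he.deriv_eq, hgh ⟨hx.1.le, hx.2⟩]

theorem integral_comp_sub (g : ℝ → E) (a b c : ℝ) :
    ω.integral (fun t => g (t - c)) a b = ω.integral g (a - c) (b - c) := by
  simp only [integral]
  rw [← intervalIntegral.integral_comp_sub_right]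
  refine intervalIntegral.integral_congr fun x _ => ?_
  rw [deriv_comp_sub_const (f := fun y => ω.π (g y))]

theorem integral_comp_const_sub (g : ℝ → E) (a b c : ℝ) :
    ω.integral (fun t => g (c - t)) a b = -ω.integral g (c - b) (c - a) := by
  simp only [integral]
  rw [← intervalIntegral.integral_comp_sub_left, ← intervalIntegral.integral_neg]
  refine intervalIntegral.integral_congr fun x _ => ?_
  rw [deriv_comp_const_sub (f := fun y => ω.π (g y)), mul_neg]

end OneForm

/-! ### Broken geodesics -/

/-- `g` restricted to `[a, b]` is an isometric embedding. -/
def IsometricOn (g : ℝ → E) (a b : ℝ) : Prop :=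
  ∀ u ∈ Icc a b, ∀ v ∈ Icc a b, dist (g u) (g v) = |u - v|

/-- `g` is isometric on each of the `k` consecutive, possibly degenerate, intervals with
endpoints `s 0 ≤ s 1 ≤ ⋯ ≤ s k`. -/
def IsBrokenAt (g : ℝ → E) (k : ℕ) (s : ℕ → ℝ) : Prop :=
  ∀ i < k, s i ≤ s (i + 1) ∧ IsometricOn g (s i) (s (i + 1))

/-- `g` restricted to `[a, b]` is a concatenation of `k` possibly degenerate geodesics. -/
def IsBroken (g : ℝ → E) (k : ℕ) (a b : ℝ) : Prop :=
  ∃ s : ℕ → ℝ, s 0 = a ∧ s k = b ∧ IsBrokenAt g k s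

variable {g h : ℝ → E} {a b c d : ℝ} {k l : ℕ} {s : ℕ → ℝ}

namespace IsometricOn

theorem mono (hg : IsometricOn g a b) (hac : a ≤ c) (hdb : d ≤ b) : IsometricOn g c d :=
  fun u hu v hv => hg u ⟨hac.trans hu.1, hu.2.trans hdb⟩ v ⟨hac.trans hv.1, hv.2.trans hdb⟩

theorem congr (hg : IsometricOn g a b) (hgh : EqOn g h (Icc a b)) : IsometricOn h a b := by
  intro u hu v hv
  rw [← hgh hu, ← hgh hv, hg u hu v hv]

theorem of_ge (h : b ≤ a) : IsometricOn g a b := by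
  intro u hu v hv
  have : u = v := by linarith [hu.1, hu.2, hv.1, hv.2]
  simp [this]

theorem comp_sub (hg : IsometricOn g a b) (c : ℝ) :
    IsometricOn (fun t => g (t - c)) (a + c) (b + c) := by
  intro u hu v hv
  have := hg (u - c) ⟨by linarith [hu.1], by linarith [hu.2]⟩
    (v - c) ⟨by linarith [hv.1], by linarith [hv.2]⟩
  simpa using this

theorem comp_const_sub (hg : IsometricOn g a b) (c : ℝ) :
    IsometricOn (fun t => g (c - t)) (c - b) (c - a) := by
  intro u hu v hv
  have := hg (c - u) ⟨by linarith [hu.2], by linarith [hu.1]⟩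
    (c - v) ⟨by linarith [hv.2], by linarith [hv.1]⟩
  rw [this, abs_sub_comm]
  congr 1
  ring

theorem hasUnitSpeedOn (hg : IsometricOn g a b) : HasUnitSpeedOn g (Icc a b) := by
  intro x hx y hy
  have h1 : eVariationOn g (Icc a b ∩ Icc x y) = eVariationOn (id : ℝ → ℝ) (Icc a b ∩ Icc x y) := by
    refine iSup_congr fun p => Finset.sum_congr rfl fun i _ => ?_
    rw [edist_dist, edist_dist, hg _ (p.2.2.2 _).1 _ (p.2.2.2 _).1]
    rfl
  rw [h1, monotone_id.monotoneOn (Icc a b) |>.eVariationOn_eq hx hy]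
  simp

end IsometricOn

theorem _root_.HasUnitSpeedOn.lipschitzOnWith (hg : HasUnitSpeedOn g (Icc a b)) :
    LipschitzOnWith 1 g (Icc a b) := by
  have key : ∀ x ∈ Icc a b, ∀ y ∈ Icc a b, x ≤ y → dist (g x) (g y) ≤ y - x := by
    intro x hx y hy hxy
    have h1 := eVariationOn.edist_le g (s := Icc a b ∩ Icc x y) (x := x) (y := y)
      ⟨hx, le_rfl, hxy⟩ ⟨hy, hxy, le_rfl⟩
    rw [hg hx hy, edist_dist, NNReal.coe_one, one_mul] at h1
    exact (ENNReal.ofReal_le_ofReal_iff (by linarith)).1 h1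
  refine LipschitzOnWith.of_dist_le_mul fun x hx y hy => ?_
  rw [NNReal.coe_one, one_mul, Real.dist_eq]
  rcases le_total x y with h | h
  · rw [abs_sub_comm]
    exact (key x hx y hy h).trans (le_abs_self _)
  · rw [dist_comm]
    exact (key y hy x hx h).trans (le_abs_self _)

namespace IsBrokenAt

theorem monotone (hs : IsBrokenAt g k s) {i j : ℕ} (hij : i ≤ j) (hj : j ≤ k) : s i ≤ s j := by
  induction j, hij using Nat.le_induction with
  | base => exact le_rfl
  | succ j hij ih => exact (ih (by omega)).trans (hs j (by omega)).1

theorem isBroken (hs : IsBrokenAt g k s) : IsBroken g k (s 0) (s k) := ⟨s, rfl, rfl, hs⟩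

theorem isBroken_drop {m : ℕ} (hs : IsBrokenAt g (m + k) s) : IsBroken g k (s m) (s (m + k)) :=
  ⟨fun i => s (m + i), rfl, rfl, fun i hi => hs (m + i) (by omega)⟩

end IsBrokenAt

namespace IsBroken

theorem le (hg : IsBroken g k a b) : a ≤ b := by
  obtain ⟨s, rfl, rfl, hs⟩ := hg
  exact hs.monotone (Nat.zero_le k) le_rfl

theorem of_isometricOn (hab : a ≤ b) (hg : IsometricOn g a b) : IsBroken g 1 a b :=
  ⟨fun i => if i = 0 then a else b, rfl, rfl, fun i hi => by
    obtain rfl : i = 0 := by omega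
    simpa using ⟨hab, hg⟩⟩

theorem hasUnitSpeedOn (hg : IsBroken g k a b) : HasUnitSpeedOn g (Icc a b) := by
  obtain ⟨s, rfl, rfl, hs⟩ := hg
  induction k with
  | zero =>
    refine hasConstantSpeedOnWith_of_subsingleton g ?_ 1
    simp
  | succ k ih =>
    exact (ih fun i hi => hs i (by omega)).Icc_Icc (hs k (by omega)).2.hasUnitSpeedOn

theorem lipschitzOnWith (hg : IsBroken g k a b) : LipschitzOnWith 1 g (Icc a b) :=
  hg.hasUnitSpeedOn.lipschitzOnWith

theorem congr (hg : IsBroken g k a b) (hgh : EqOn g h (Icc a b)) : IsBroken h k a b := by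
  obtain ⟨s, rfl, rfl, hs⟩ := hg
  refine ⟨s, rfl, rfl, fun i hi => ⟨(hs i hi).1, (hs i hi).2.congr (hgh.mono ?_)⟩⟩
  exact Icc_subset_Icc (hs.monotone (Nat.zero_le _) (by omega)) (hs.monotone (by omega) le_rfl)

theorem comp_sub (hg : IsBroken g k a b) (c : ℝ) :
    IsBroken (fun t => g (t - c)) k (a + c) (b + c) := by
  obtain ⟨s, rfl, rfl, hs⟩ := hg
  exact ⟨fun i => s i + c, rfl, rfl, fun i hi =>
    ⟨add_le_add_left (hs i hi).1 c, (hs i hi).2.comp_sub c⟩⟩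

theorem trans (hg : IsBroken g k a b) (hg' : IsBroken g l b c) : IsBroken g (k + l) a c := by
  obtain ⟨s, rfl, hb, hs⟩ := hg
  obtain ⟨s', hb', rfl, hs'⟩ := hg'
  refine ⟨fun i => if i ≤ k then s i else s' (i - k), by simp, ?_, fun i hi => ?_⟩
  · rcases Nat.eq_zero_or_pos l with rfl | hl
    · simp [hb, hb']
    · simp [show ¬ (k + l ≤ k) by omega]
  · rcases lt_trichotomy i k with h | rfl | h
    · simpa [h.le, Nat.succ_le_of_lt h] using hs i h
    · simpa [hb, ← hb'] using hs' 0 (by omega)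
    · simpa [show ¬ i ≤ k by omega, show ¬ i + 1 ≤ k by omega,
        show i + 1 - k = i - k + 1 by omega] using hs' (i - k) (by omega)

theorem restrict_left (hg : IsBroken g k a b) (hac : a ≤ c) (hcb : c ≤ b) : IsBroken g k a c := by
  obtain ⟨s, rfl, rfl, hs⟩ := hg
  refine ⟨fun i => min (s i) c, min_eq_left hac, min_eq_right hcb, fun i hi =>
    ⟨min_le_min_right c (hs i hi).1, ?_⟩⟩
  rcases le_total (s i) c with h | h
  · exact (hs i hi).2.mono (by simp [h]) (min_le_left _ _)
  · exact IsometricOn.of_ge (by simp [h])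

theorem restrict_right (hg : IsBroken g k a b) (hac : a ≤ c) (hcb : c ≤ b) :
    IsBroken g k c b := by
  obtain ⟨s, rfl, rfl, hs⟩ := hg
  refine ⟨fun i => max (s i) c, max_eq_right hac, max_eq_left hcb, fun i hi =>
    ⟨max_le_max_right c (hs i hi).1, ?_⟩⟩
  rcases le_total (s (i + 1)) c with h | h
  · exact IsometricOn.of_ge (by simp [h])
  · exact (hs i hi).2.mono (le_max_left _ _) (by simp [h])

/-- Degenerate edges may be discarded. -/
theorem exists_strict (hg : IsBroken g k a b) : ∃ (m : ℕ) (s : ℕ → ℝ), s 0 = a ∧ s m = b ∧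
    ∀ i < m, s i < s (i + 1) ∧ IsometricOn g (s i) (s (i + 1)) := by
  obtain ⟨s, rfl, rfl, hs⟩ := hg
  induction k with
  | zero => exact ⟨0, s, rfl, rfl, by simp⟩
  | succ k ih =>
    obtain ⟨m, s', h0, hm, h⟩ := ih fun i hi => hs i (by omega)
    rcases (hs k (by omega)).1.eq_or_lt with he | hlt
    · exact ⟨m, s', h0, hm.trans he, h⟩
    · refine ⟨m + 1, fun i => if i ≤ m then s' i else s (k + 1), by simp [h0], by simp,
        fun i hi => ?_⟩
      rcases (Nat.lt_succ_iff.1 hi).eq_or_lt with rfl | hi'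
      · simpa [hm] using ⟨hlt, (hs k (by omega)).2⟩
      · simpa [hi'.le, Nat.succ_le_of_lt hi'] using h i hi'

end IsBroken

/-! ### Passage between unit speed maps and `ArcCurve` -/

namespace ArcCurve

/-- A unit speed map on `[a, b]`, reparametrized on `[0, b - a]`. -/
def ofUnitSpeed (g : ℝ → E) (a b : ℝ) (hab : a ≤ b) (hg : HasUnitSpeedOn g (Icc a b)) :
    ArcCurve E where
  toFun t := g (t + a)
  len := b - a
  len_nonneg := sub_nonneg.2 hab
  arclength t ht := by
    have h := eVariationOn.comp_eq_of_monotoneOn g (t := Icc 0 t) (fun x : ℝ => x + a)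
      (fun x _ y _ hxy => add_le_add_left hxy a)
    rw [image_add_const_Icc, zero_add] at h
    have h' := hg (x := a) ⟨le_rfl, hab⟩ (y := t + a)
      ⟨by linarith [ht.1], by linarith [ht.2]⟩
    rw [inter_eq_right.2 (Icc_subset_Icc_right (by linarith [ht.2]))] at h'
    refine (h.trans h').trans ?_
    simp

variable {hab : a ≤ b} {hg : HasUnitSpeedOn g (Icc a b)}

@[simp]
theorem ofUnitSpeed_len : (ofUnitSpeed g a b hab hg).len = b - a := rfl

theorem ofUnitSpeed_isClosed (h : g a = g b) : (ofUnitSpeed g a b hab hg).IsClosed := by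
  simp [IsClosed, ofUnitSpeed, h]

theorem ofUnitSpeed_isPiecewiseGeodesic (h : IsBroken g k a b) :
    (ofUnitSpeed g a b hab hg).IsPiecewiseGeodesic := by
  have h' : IsBroken (fun t => g (t + a)) k 0 (b - a) := by
    simpa [← sub_eq_add_neg] using h.comp_sub (-a)
  obtain ⟨m, s, h0, hm, hs⟩ := h'.exists_strict
  exact ⟨m, s, h0, hm, hs⟩

theorem ofUnitSpeed_current (ω : OneForm E) :
    (ofUnitSpeed g a b hab hg).current ω = ω.integral g a b := by
  have hL : LipschitzOnWith 1 (fun t => g (t + a)) (Icc 0 (b - a)) := by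
    refine LipschitzOnWith.of_dist_le_mul fun x hx y hy => ?_
    simpa using hg.lipschitzOnWith.dist_le_mul (x + a) ⟨by linarith [hx.1], by linarith [hx.2]⟩
      (y + a) ⟨by linarith [hy.1], by linarith [hy.2]⟩
  have h := ω.rsIntegral_eq (sub_nonneg.2 hab) hL
  have h' := ω.integral_comp_sub g 0 (b - a) (-a)
  simp only [sub_neg_eq_add, zero_add, sub_add_cancel] at h'
  exact h.trans h'

theorem ofUnitSpeed_morrey_le {M : ℝ} (hM : 0 ≤ M)
    (h : ∀ x : E, ∀ r > 0, volume {t ∈ Icc a b | dist x (g t) ≤ r} ≤ ENNReal.ofReal (M * r)) :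
    (ofUnitSpeed g a b hab hg).morrey ≤ ENNReal.ofReal M := by
  refine iSup_le fun x => iSup_le fun r => iSup_le fun hr => ?_
  refine ENNReal.div_le_of_le_mul ?_
  rw [← ENNReal.ofReal_mul hM]
  refine le_trans (le_of_eq ?_) (h x r hr)
  rw [← measure_preimage_add_right volume a {t ∈ Icc a b | dist x (g t) ≤ r}]
  congr 1
  ext t
  simp only [ofUnitSpeed, mem_ofPred_eq, mem_Icc, mem_preimage]
  constructor
  · rintro ⟨⟨h1, h2⟩, h3⟩
    exact ⟨⟨by linarith, by linarith⟩, h3⟩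
  · rintro ⟨⟨h1, h2⟩, h3⟩
    exact ⟨⟨by linarith, by linarith⟩, h3⟩

theorem isBroken_of_isResolution {γ : ArcCurve E} (h : γ.IsResolution k s) :
    IsBroken γ.toFun k 0 γ.len :=
  ⟨s, h.1, h.2.1, fun i hi => ⟨(h.2.2 i hi).1.le, (h.2.2 i hi).2⟩⟩

theorem current_eq_integral {γ : ArcCurve E} (h : γ.IsPiecewiseGeodesic) (ω : OneForm E) :
    γ.current ω = ω.integral γ.toFun 0 γ.len := by
  obtain ⟨k, s, hs⟩ := h
  exact ω.rsIntegral_eq γ.len_nonneg (isBroken_of_isResolution hs).lipschitzOnWith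

end ArcCurve

/-! ### Time spent in balls -/

theorem volume_le_of_abs_sub_le {A : Set ℝ} {c : ℝ} (hA : ∀ x ∈ A, ∀ y ∈ A, |x - y| ≤ c) :
    volume A ≤ ENNReal.ofReal c := by
  refine (Real.volume_le_diam A).trans (Metric.ediam_le fun x hx y hy => ?_)
  rw [edist_dist, Real.dist_eq]
  exact ENNReal.ofReal_le_ofReal (hA x hx y hy)

theorem dist_le_two_mul {x y z : E} {r : ℝ} (hy : dist x y ≤ r) (hz : dist x z ≤ r) :
    dist y z ≤ 2 * r := by
  linarith [dist_triangle_left y z x]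

theorem IsometricOn.volume_le (hg : IsometricOn g a b) (x : E) (r : ℝ) :
    volume {t ∈ Icc a b | dist x (g t) ≤ r} ≤ ENNReal.ofReal (2 * r) := by
  refine volume_le_of_abs_sub_le fun p hp q hq => ?_
  rw [← hg p hp.1 q hq.1]
  exact dist_le_two_mul hp.2 hq.2

theorem IsBroken.volume_le (hg : IsBroken g k a b) (x : E) (r : ℝ) :
    volume {t ∈ Icc a b | dist x (g t) ≤ r} ≤ k * ENNReal.ofReal (2 * r) := by
  obtain ⟨s, rfl, rfl, hs⟩ := hg
  induction k with
  | zero =>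
    refine le_trans (measure_mono (t := {s 0}) ?_) (by simp)
    rintro t ⟨ht, -⟩
    exact le_antisymm ht.2 ht.1
  | succ k ih =>
    have hsub : {t ∈ Icc (s 0) (s (k + 1)) | dist x (g t) ≤ r} ⊆
        {t ∈ Icc (s 0) (s k) | dist x (g t) ≤ r} ∪
          {t ∈ Icc (s k) (s (k + 1)) | dist x (g t) ≤ r} := by
      rintro t ⟨ht, htr⟩
      rcases le_total t (s k) with h | h
      · exact Or.inl ⟨⟨ht.1, h⟩, htr⟩
      · exact Or.inr ⟨⟨h, ht.2⟩, htr⟩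
    refine (measure_mono hsub).trans ((measure_union_le _ _).trans ?_)
    push_cast
    rw [add_mul, one_mul]
    exact add_le_add (ih fun i hi => hs i (by omega)) ((hs k (by omega)).2.volume_le x r)

/-- A set of times no two of which are separated by two consecutive edges lies in at most three
consecutive edges. -/
theorem IsBrokenAt.exists_three_edges (hs : IsBrokenAt g k s) {A : Set ℝ}
    (hA : A ⊆ Icc (s 0) (s k))
    (hsep : ∀ p ∈ A, ∀ q ∈ A, ∀ i, i + 2 ≤ k → p ≤ s i → ¬ s (i + 2) ≤ q) :
    ∃ j m, m ≤ 3 ∧ j + m ≤ k ∧ A ⊆ Icc (s j) (s (j + m)) := by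
  classical
  rcases A.eq_empty_or_nonempty with rfl | ⟨p₀, hp₀⟩
  · exact ⟨0, 0, by omega, by omega, empty_subset _⟩
  have hex : ∃ i, i ≤ k ∧ ∃ p ∈ A, p ≤ s i := ⟨k, le_rfl, p₀, hp₀, (hA hp₀).2⟩
  obtain ⟨hik, p, hp, hpi⟩ := Nat.find_spec hex
  -- By minimality of `i`, all of `A` lies after `s (i - 1)`; as some `p ∈ A` precedes `s i`, all of
  -- `A` lies before `s (i + 2)`. The truncated `i - 1` and the `min` cover the two ends of the
  -- curve.
  set i := Nat.find hex with hi
  refine ⟨i - 1, min 3 (k - (i - 1)), min_le_left _ _, by omega, fun q hq => ⟨?_, ?_⟩⟩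
  · rcases Nat.eq_zero_or_pos i with h0 | h0
    · rw [h0]
      exact (hA hq).1
    · have hmin := Nat.find_min hex (m := i - 1) (by omega)
      by_contra hlt
      exact hmin ⟨by omega, q, hq, (not_le.1 hlt).le⟩
  · rcases le_total (i + 2) k with h2 | h2
    · have := hsep p hp q hq i h2 hpi
      exact (not_le.1 this).le.trans (hs.monotone (by omega) (by omega))
    · exact (hA hq).2.trans (hs.monotone (by omega) (by omega))

/-- Either `A` lies in three edges, each contributing at most `2 * r`, or some pair in `A` is
separated by two edges and `hlow` bounds the diameter of `A` by `2 * ε⁻¹ * r`. The sum of the two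
bounds covers both cases. -/
theorem IsBrokenAt.volume_le (hs : IsBrokenAt g k s) {A : Set ℝ} {x : E} {r ε : ℝ}
    (hε : 0 < ε) (hr : 0 < r) (hA : A ⊆ Icc (s 0) (s k)) (hx : ∀ t ∈ A, dist x (g t) ≤ r)
    (hlow : ∀ p ∈ A, ∀ q ∈ A, ∀ i, i + 2 ≤ k → p ≤ s i → s (i + 2) ≤ q →
      ε * (q - p) ≤ dist (g p) (g q)) :
    volume A ≤ ENNReal.ofReal ((2 * ε⁻¹ + 6) * r) := by
  by_cases hsep : ∀ p ∈ A, ∀ q ∈ A, ∀ i, i + 2 ≤ k → p ≤ s i → ¬ s (i + 2) ≤ q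
  · obtain ⟨j, m, hm, hjm, hAj⟩ := hs.exists_three_edges hA hsep
    have hb : IsBroken g m (s j) (s (j + m)) :=
      IsBrokenAt.isBroken_drop fun i hi => hs i (by omega)
    calc volume A ≤ volume {t ∈ Icc (s j) (s (j + m)) | dist x (g t) ≤ r} :=
          measure_mono fun t ht => ⟨hAj ht, hx t ht⟩
      _ ≤ m * ENNReal.ofReal (2 * r) := hb.volume_le x r
      _ ≤ (3 : ℕ) * ENNReal.ofReal (2 * r) := by gcongr
      _ = ENNReal.ofReal (3 * (2 * r)) := by
          rw [ENNReal.ofReal_mul (by norm_num)]; simp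
      _ ≤ _ := ENNReal.ofReal_le_ofReal (by
          have : 0 < ε⁻¹ * r := by positivity
          linarith)
  · push Not at hsep
    obtain ⟨p, hp, q, hq, i, hi, hpi, hiq⟩ := hsep
    refine (volume_le_of_abs_sub_le (c := 2 * ε⁻¹ * r) fun p' hp' q' hq' => ?_).trans
      (ENNReal.ofReal_le_ofReal (by nlinarith))
    -- Spreading `p', q'` to the extremes of `p, q, p', q'` gives a pair still separated by the same
    -- two edges, so `hlow` applies even when `p', q'` are close.
    have hP : min p (min p' q') ∈ A := by
      rcases min_choice p (min p' q') with h | h <;> rw [h]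
      · exact hp
      · rcases min_choice p' q' with h | h <;> rw [h] <;> assumption
    have hQ : max q (max p' q') ∈ A := by
      rcases max_choice q (max p' q') with h | h <;> rw [h]
      · exact hq
      · rcases max_choice p' q' with h | h <;> rw [h] <;> assumption
    have h1 := hlow _ hP _ hQ i hi ((min_le_left _ _).trans hpi) (hiq.trans (le_max_left _ _))
    have h2 := h1.trans (dist_le_two_mul (hx _ hP) (hx _ hQ))
    have h3 : max q (max p' q') - min p (min p' q') ≤ 2 * ε⁻¹ * r := by
      have : 2 * ε⁻¹ * r = 2 * r / ε := by field_simp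
      rw [this, le_div_iff₀ hε]
      linarith
    refine le_trans ?_ h3
    rw [abs_sub_le_iff]
    have e1 : p' ≤ max q (max p' q') := (le_max_left _ _).trans (le_max_right _ _)
    have e2 : q' ≤ max q (max p' q') := (le_max_right _ _).trans (le_max_right _ _)
    have e3 : min p (min p' q') ≤ p' := (min_le_right _ _).trans (min_le_left _ _)
    have e4 : min p (min p' q') ≤ q' := (min_le_right _ _).trans (min_le_right _ _)
    constructor <;> linarith

/-! ### Cutting off a shortest arc -/

/-- Among the arcs of a closed broken geodesic that contain two consecutive edges and whose
endpoints are close relative to their length, there is a shortest one. -/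
theorem IsBrokenAt.exists_shortest_arc (hs : IsBrokenAt g k s) (hk : 2 ≤ k)
    (hclosed : g (s 0) = g (s k)) {ε : ℝ} (hε : 0 < ε) :
    ∃ u v i, i + 2 ≤ k ∧ s 0 ≤ u ∧ u ≤ s i ∧ s (i + 2) ≤ v ∧ v ≤ s k ∧
      dist (g u) (g v) ≤ ε * (v - u) ∧
      ∀ p q j, j + 2 ≤ k → s 0 ≤ p → p ≤ s j → s (j + 2) ≤ q → q ≤ s k →
        dist (g p) (g q) ≤ ε * (q - p) → v - u ≤ q - p := by
  have hcont : ContinuousOn g (Icc (s 0) (s k)) := hs.isBroken.lipschitzOnWith.continuousOn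
  set K : ℕ → Set (ℝ × ℝ) := fun i =>
    {p ∈ Icc (s 0) (s i) ×ˢ Icc (s (i + 2)) (s k) | dist (g p.1) (g p.2) ≤ ε * (p.2 - p.1)}
  have hK : ∀ i ∈ {i | i + 2 ≤ k}, IsCompact (K i) := by
    intro i hi
    have hi : i + 2 ≤ k := hi
    refine (isCompact_Icc.prod isCompact_Icc).of_isClosed_subset ?_ (sep_subset _ _)
    refine (isClosed_Icc.prod isClosed_Icc).isClosed_le ?_ (by fun_prop)
    refine continuous_dist.comp_continuousOn
      ((hcont.comp continuousOn_fst ?_).prodMk (hcont.comp continuousOn_snd ?_))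
    · exact fun p hp => ⟨hp.1.1, hp.1.2.trans (hs.monotone (by omega) le_rfl)⟩
    · exact fun p hp => ⟨(hs.monotone (by omega) hi).trans hp.2.1, hp.2.2⟩
  have hfin : {i | i + 2 ≤ k}.Finite := (finite_le_nat k).subset fun i hi => by
    have : i + 2 ≤ k := hi
    exact (by omega : i ≤ k)
  -- The length `v - u` is minimized over a finite union of compact sets, nonempty because it
  -- contains the whole closed curve.
  have hcomp := hfin.isCompact_biUnion hK
  have hne : (⋃ i ∈ {i | i + 2 ≤ k}, K i).Nonempty := by
    refine ⟨(s 0, s k), mem_biUnion (show 0 ∈ {i | i + 2 ≤ k} from hk) ?_⟩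
    refine ⟨⟨⟨le_rfl, le_rfl⟩, hs.monotone hk le_rfl, le_rfl⟩, ?_⟩
    have := hs.monotone (Nat.zero_le k) le_rfl
    simp only [hclosed, dist_self]
    exact mul_nonneg hε.le (by linarith)
  obtain ⟨⟨u, v⟩, huv, hmin⟩ := hcomp.exists_isMinOn hne
    (f := fun p : ℝ × ℝ => p.2 - p.1) (by fun_prop)
  obtain ⟨i, hi, ⟨⟨h1, h2⟩, h3, h4⟩, h5⟩ := mem_iUnion₂.1 huv
  refine ⟨u, v, i, hi, h1, h2, h3, h4, h5, fun p q j hj e1 e2 e3 e4 e5 => ?_⟩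
  have hpq : (p, q) ∈ K j := ⟨⟨⟨e1, e2⟩, e3, e4⟩, e5⟩
  exact hmin (mem_biUnion (show j ∈ {i | i + 2 ≤ k} from hj) hpq)

/-- The map equal to `g` up to time `b` and to `h` afterwards. -/
noncomputable def glue {X : Type*} (g h : ℝ → X) (b : ℝ) (t : ℝ) : X := if t ≤ b then g t else h t

theorem eqOn_glue_left {X : Type*} {g h : ℝ → X} {a b : ℝ} : EqOn g (glue g h b) (Icc a b) :=
  fun t ht => by simp [glue, ht.2]

theorem eqOn_glue_right {X : Type*} {g h : ℝ → X} {b c : ℝ} (hgh : g b = h b) :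
    EqOn h (glue g h b) (Icc b c) := fun t ht => by
  rcases ht.1.eq_or_lt with rfl | hlt
  · simp [glue, hgh]
  · simp [glue, hlt]

theorem IsBroken.glued (hg : IsBroken g k a b) (hh : IsBroken h l b c) (hgh : g b = h b) :
    IsBroken (glue g h b) (k + l) a c :=
  (hg.congr eqOn_glue_left).trans (hh.congr (eqOn_glue_right hgh))

theorem IsBroken.integral_glue (ω : OneForm E) (hg : IsBroken g k a b) (hh : IsBroken h l b c)
    (hgh : g b = h b) :
    ω.integral (glue g h b) a c = ω.integral g a b + ω.integral h b c := by
  rw [← ω.integral_add_adjacent hg.le hh.le (hg.glued hh hgh).lipschitzOnWith,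
    ← ω.integral_congr hg.le eqOn_glue_left, ← ω.integral_congr hh.le (eqOn_glue_right hgh)]

theorem IsGeodesicSpace.exists_isometricOn (hE : IsGeodesicSpace E) (x y : E) :
    ∃ η : ℝ → E, IsometricOn η 0 (dist x y) ∧ η 0 = x ∧ η (dist x y) = y := by
  obtain ⟨γ, hγ, h0, h1⟩ := hE x y
  have hlen : dist x y = γ.len := by
    have := hγ 0 ⟨le_rfl, γ.len_nonneg⟩ γ.len ⟨γ.len_nonneg, le_rfl⟩
    rwa [h0, h1, zero_sub, abs_neg, abs_of_nonneg γ.len_nonneg] at this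
  exact ⟨γ.toFun, hlen ▸ hγ, h0, hlen ▸ h1⟩

/-- A closed broken geodesic with `k + 2` edges splits, as a current, into a closed curve of
controlled Morrey norm and a closed broken geodesic with `k + 1` edges. -/
theorem IsBroken.exists_split (hE : IsGeodesicSpace E) {ε : ℝ} (hε : 0 < ε)
    (hg : IsBroken g (k + 2) a b) (hclosed : g a = g b) :
    ∃ (β : ArcCurve E) (g' : ℝ → E) (b' L : ℝ),
      (β.IsPiecewiseGeodesic ∧ β.IsClosed) ∧
      β.morrey ≤ ENNReal.ofReal (2 * ε⁻¹ + 8) ∧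
      IsBroken g' (k + 1) a b' ∧ g' a = g' b' ∧
      (∀ ω : OneForm E, ω.integral g a b = β.current ω + ω.integral g' a b') ∧
      β.len ≤ (1 + ε) * L ∧ b' - a ≤ b - a - (1 - ε) * L := by
  have hg₀ := hg
  obtain ⟨s, rfl, rfl, hs⟩ := hg
  obtain ⟨u, v, i, hi, h0u, hui, hiv, hvk, hd, hmin⟩ :=
    hs.exists_shortest_arc (by omega) hclosed hε
  obtain ⟨η, hη, hη0, hη1⟩ := hE.exists_isometricOn (g u) (g v)
  set d := dist (g u) (g v)
  have hd0 : 0 ≤ d := dist_nonneg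
  have huv : u ≤ v := hui.trans ((hs.monotone (by omega) hi).trans hiv)
  have hgau : IsBroken g i (s 0) u :=
    (IsBrokenAt.isBroken fun j hj => hs j (by omega)).restrict_left h0u hui
  have hgvb : IsBroken g (k - i) v (s (k + 2)) := by
    have : IsBroken g (k - i) (s (i + 2)) (s (i + 2 + (k - i))) :=
      IsBrokenAt.isBroken_drop fun j hj => hs j (by omega)
    rw [show i + 2 + (k - i) = k + 2 by omega] at this
    exact this.restrict_right hiv hvk
  have hguv : IsBroken g (k + 2) u v :=
    (hg₀.restrict_right h0u (huv.trans hvk)).restrict_left huv hvk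
  -- The chord run backwards, from `g v` to `g u`, closes the arc into the loop `β`.
  have hback : IsometricOn (fun t => η (v + d - t)) v (v + d) := by
    simpa using hη.comp_const_sub (v + d)
  have hback' : IsBroken (fun t => η (v + d - t)) 1 v (v + d) :=
    IsBroken.of_isometricOn (by linarith) hback
  have hjoin : g v = η (v + d - v) := by simp [hη1]
  have hβ := hguv.glued hback' hjoin
  set β := glue g (fun t => η (v + d - t)) v
  have hβl : EqOn g β (Icc u v) := eqOn_glue_left
  have hβr : EqOn (fun t => η (v + d - t)) β (Icc v (v + d)) := eqOn_glue_right hjoin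
  have hβclosed : β u = β (v + d) := by
    rw [← hβl ⟨le_rfl, huv⟩, ← hβr ⟨by linarith, le_rfl⟩]
    simp [hη0]
  have hforth : IsBroken (fun t => η (t - u)) 1 u (u + d) := by
    refine IsBroken.of_isometricOn (by linarith) ?_
    simpa [add_comm] using hη.comp_sub u
  have hrest : IsBroken (fun t => g (t - (u + d - v))) (k - i) (u + d)
      (s (k + 2) + (u + d - v)) := by
    simpa using hgvb.comp_sub (u + d - v)
  have hjoin₁ : η (u + d - u) = g (u + d - (u + d - v)) := by simp [hη1]
  have hjoin₂ : g u = glue (fun t => η (t - u)) (fun t => g (t - (u + d - v))) (u + d) u := by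
    rw [← eqOn_glue_left (a := u) (⟨le_rfl, by linarith⟩ : u ∈ Icc u (u + d))]
    simp [hη0]
  have hshort := hforth.glued hrest hjoin₁
  refine ⟨ArcCurve.ofUnitSpeed β u (v + d) hβ.le hβ.hasUnitSpeedOn,
    glue g (glue (fun t => η (t - u)) (fun t => g (t - (u + d - v))) (u + d)) u,
    s (k + 2) + (u + d - v), v - u,
    ⟨ArcCurve.ofUnitSpeed_isPiecewiseGeodesic hβ, ArcCurve.ofUnitSpeed_isClosed hβclosed⟩,
    ?_, ?_, ?_, fun ω => ?_, ?_, ?_⟩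
  · refine ArcCurve.ofUnitSpeed_morrey_le (by positivity) fun x r hr => ?_
    -- Leaving `v` out of the arc makes every pair of its times strictly closer than `v - u`, so
    -- that `hmin` excludes it. The chord accounts for the extra `2 * r`.
    have hsub : {t ∈ Icc u (v + d) | dist x (β t) ≤ r} ⊆
        {t ∈ Ico u v | dist x (g t) ≤ r} ∪ {t ∈ Icc v (v + d) | dist x (β t) ≤ r} := by
      rintro t ⟨ht, htr⟩
      rcases lt_or_ge t v with h | h
      · refine Or.inl ⟨⟨ht.1, h⟩, ?_⟩
        rwa [hβl ⟨ht.1, h.le⟩]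
      · exact Or.inr ⟨⟨h, ht.2⟩, htr⟩
    have h1 : volume {t ∈ Ico u v | dist x (g t) ≤ r} ≤
        ENNReal.ofReal ((2 * ε⁻¹ + 6) * r) := by
      refine hs.volume_le hε hr (fun t ht => ⟨h0u.trans ht.1.1, ht.1.2.le.trans hvk⟩)
        (fun t ht => ht.2) fun p hp q hq j hj hpj hjq => ?_
      by_contra hlt
      have := hmin p q j hj (h0u.trans hp.1.1) hpj hjq (hq.1.2.le.trans hvk) (not_le.1 hlt).le
      linarith [hp.1.1, hq.1.2]
    have h2 := (hback.congr hβr).volume_le x r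
    refine (measure_mono hsub).trans ((measure_union_le _ _).trans ((add_le_add h1 h2).trans ?_))
    rw [← ENNReal.ofReal_add (by positivity) (by positivity)]
    exact ENNReal.ofReal_le_ofReal (by linarith)
  · have := hgau.glued hshort hjoin₂
    -- `i` edges before `u`, the chord, and `k - i` edges after `v`: the count drops by one.
    rwa [show i + (1 + (k - i)) = k + 1 by omega] at this
  · rw [← eqOn_glue_left (a := s 0) (⟨le_rfl, h0u⟩ : s 0 ∈ Icc (s 0) u),
      ← eqOn_glue_right hjoin₂ ⟨hshort.le, le_rfl⟩,
      ← eqOn_glue_right hjoin₁ ⟨hrest.le, le_rfl⟩, hclosed]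
    simp
  · rw [ArcCurve.ofUnitSpeed_current, hguv.integral_glue ω hback' hjoin,
      hgau.integral_glue ω hshort hjoin₂, hforth.integral_glue ω hrest hjoin₁,
      ω.integral_comp_sub, ω.integral_comp_sub, ω.integral_comp_const_sub,
      ← ω.integral_add_adjacent (h0u.trans huv) hvk hg₀.lipschitzOnWith,
      ← ω.integral_add_adjacent h0u huv
        (hg₀.lipschitzOnWith.mono (Icc_subset_Icc_right hvk))]
    -- The two passages along `η` have opposite signs and cancel.
    simp
    ring
  · rw [ArcCurve.ofUnitSpeed_len]
    linarith
  · linarith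

theorem IsBroken.exists_decomposition (hE : IsGeodesicSpace E) {ε : ℝ} (hε0 : 0 < ε)
    (hε1 : ε < 1) (hg : IsBroken g k a b) (hclosed : g a = g b) :
    ∃ (N : ℕ) (c : Fin N → ArcCurve E), 0 < N ∧
      (∀ j, (c j).IsPiecewiseGeodesic ∧ (c j).IsClosed) ∧
      (∀ ω : OneForm E, ω.integral g a b = ∑ j, (c j).current ω) ∧
      ∑ j, (c j).len ≤ (1 + ε) / (1 - ε) * (b - a) ∧
      ∀ j, (c j).morrey ≤ ENNReal.ofReal (2 * ε⁻¹ + 8) := by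
  have base : ∀ {g : ℝ → E} {k : ℕ} {a : ℝ}, IsBroken g k a a →
      ∃ (N : ℕ) (c : Fin N → ArcCurve E), 0 < N ∧
      (∀ j, (c j).IsPiecewiseGeodesic ∧ (c j).IsClosed) ∧
      (∀ ω : OneForm E, ω.integral g a a = ∑ j, (c j).current ω) ∧
      ∑ j, (c j).len ≤ (1 + ε) / (1 - ε) * (a - a) ∧
      ∀ j, (c j).morrey ≤ ENNReal.ofReal (2 * ε⁻¹ + 8) := by
    intro g k a hg
    refine ⟨1, fun _ => ArcCurve.ofUnitSpeed g a a le_rfl hg.hasUnitSpeedOn, one_pos,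
      fun _ => ⟨ArcCurve.ofUnitSpeed_isPiecewiseGeodesic hg, ArcCurve.ofUnitSpeed_isClosed rfl⟩,
      fun ω => by simp [ArcCurve.ofUnitSpeed_current], by simp, fun _ => ?_⟩
    refine ArcCurve.ofUnitSpeed_morrey_le (by positivity) fun x r hr => ?_
    refine le_trans (measure_mono (t := {a}) ?_) (by simp)
    rintro t ⟨ht, -⟩
    exact le_antisymm ht.2 ht.1
  induction k generalizing g b with
  | zero =>
    obtain rfl : a = b := by
      obtain ⟨s, rfl, rfl, -⟩ := hg
      rfl
    exact base hg
  | succ k ih =>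
    rcases Nat.eq_zero_or_pos k with rfl | hk
    -- A closed curve with a single geodesic edge has length zero.
    · obtain rfl : a = b := by
        have hab := hg.le
        obtain ⟨s, rfl, rfl, hs⟩ := hg
        have := (hs 0 one_pos).2 _ ⟨le_rfl, hab⟩ _ ⟨hab, le_rfl⟩
        rw [zero_add] at hclosed
        rw [zero_add, hclosed, dist_self] at this
        exact sub_eq_zero.1 (abs_eq_zero.1 this.symm)
      exact base hg
    · obtain ⟨m, rfl⟩ : ∃ m, k = m + 1 := ⟨k - 1, by omega⟩
      obtain ⟨β, g', b', L, hβ, hβM, hg', hclosed', hint, hlen, hlen'⟩ :=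
        hg.exists_split hE hε0 hclosed
      obtain ⟨N, c, -, hc, hcint, hclen, hcM⟩ := ih hg' hclosed'
      refine ⟨N + 1, Fin.cons β c, Nat.succ_pos N, Fin.cases hβ hc, fun ω => ?_, ?_,
        Fin.cases hβM hcM⟩
      · rw [hint, hcint, Fin.sum_univ_succ]
        simp
      · rw [Fin.sum_univ_succ]
        simp only [Fin.cons_zero, Fin.cons_succ]
        have h1 : 0 < 1 - ε := by linarith
        have h2 : (1 + ε) / (1 - ε) * (b' - a) ≤
            (1 + ε) / (1 - ε) * (b - a - (1 - ε) * L) :=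
          mul_le_mul_of_nonneg_left hlen' (by positivity)
        -- The length removed pays exactly for the bound `(1 + ε) * L` on `β`.
        have h3 : (1 + ε) / (1 - ε) * (b - a - (1 - ε) * L) =
            (1 + ε) / (1 - ε) * (b - a) - (1 + ε) * L := by
          field_simp
        linarith

end Surgery

end

theorem lemma3p1 {E : Type*} [MetricSpace E] (hE : Surgery.IsGeodesicSpace E)
    (ε : ℝ) (hε0 : 0 < ε) (hε1 : ε < 1) (n : ℕ) (hn : 0 < n)
    (γ : Surgery.ArcCurve E) (hγ : γ.IsPiecewiseGeodesic) (hγc : γ.IsClosed) :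
    ∃ (N : ℕ) (c : Fin N → Surgery.ArcCurve E), 0 < N ∧
      (∀ j, (c j).IsPiecewiseGeodesic ∧ (c j).IsClosed) ∧
      γ.current = ∑ j, (c j).current ∧
      ∑ j, (c j).len ≤
        (1 + 2 * ε / (1 - ε) + 12 * ε⁻¹ / ((n : ℝ) * (1 - ε))) * γ.len ∧
      ∀ j, (c j).morrey ≤ ENNReal.ofReal (4 * ε⁻¹ + 2 * (n : ℝ) + 10) := by
  obtain ⟨k, s, hs⟩ := id hγ
  obtain ⟨N, c, hN, hc, hint, hlen, hM⟩ :=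
    (Surgery.ArcCurve.isBroken_of_isResolution hs).exists_decomposition hE hε0 hε1 hγc.symm
  have h1 : 0 < 1 - ε := by linarith
  refine ⟨N, c, hN, hc, ?_, hlen.trans ?_, fun j => (hM j).trans ?_⟩
  · funext ω
    rw [Surgery.ArcCurve.current_eq_integral hγ, hint, Finset.sum_apply]
  · rw [sub_zero]
    refine mul_le_mul_of_nonneg_right ?_ γ.len_nonneg
    -- The decomposition already meets the first two terms of the length bound; the third is slack.
    have h2 : (1 + ε) / (1 - ε) = 1 + 2 * ε / (1 - ε) := by field_simp; ring
    have h3 : 0 ≤ 12 * ε⁻¹ / ((n : ℝ) * (1 - ε)) := by positivity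
    linarith
  · refine ENNReal.ofReal_le_ofReal ?_
    have h2 : 0 < ε⁻¹ := inv_pos.2 hε0
    have h3 : (0 : ℝ) ≤ n := n.cast_nonneg
    linarith
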